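/- Let $(M,g)$ be a connected (finite-dimensional, Hausdorff, boundaryless) smooth Riemannian manifold with Riemannian distance $d$ and Levi-Civita connection $\nabla$, and let $X$ be a smooth vector field on $M$ with (maximal local) flow $\mathrm{Fl}^X$; neither $M$ nor $X$ is assumed to be complete. Let $p_0,q_0\in M$, and let $N\subseteq M$ be a relatively compact smooth embedded submanifold containing $p_0$ and $q_0$ such that $d(p_0,q_0)=d_N(p_0,q_0)$, where $d_N$ is the Riemannian distance of $N$ with the metric induced by $g$ ($d_N=\infty$ for points in different components of $N$). Let $T>0$ be such that $\mathrm{Fl}^X$ is defined on $[0,T]\times N$, put $p(t)=\mathrm{Fl}^X_t(p_0)$, $q(t)=\mathrm{Fl}^X_t(q_0)$, and $$C_T:=\sup\{\|\nabla X(p)\|_g : p\in \mathrm{Fl}^X([0,T]\times N)\}\in[0,\infty],$$ where $\|\nabla X(p)\|_g$ is the operator norm of $Y\mapsto\nabla_Y X$ on $(T_pM,\|\cdot\|_g)$. Then $$d(p(t),q(t))\le d(p_0,q_0)\,e^{C_T t}\qquad (t\in[0,T]),$$ where, should $C_T=\infty$, one uses the conventions $\infty\cdot 0=0\cdot\infty=0$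 and $e^{\infty}=\infty$. -/

import Mathlib

open Set Manifold Bundle
open scoped ContDiff ENNReal Topology

noncomputable section LeviCivita

variable {E : Type*} [NormedAddCommGroup E] [NormedSpace ℝ E]
  {M : Type*} [TopologicalSpace M] [ChartedSpace E M]
  [RiemannianBundle (fun x : M => TangentSpace 𝓘(ℝ, E) x)]

/-- The right-hand side of the Koszul formula: for the Levi-Civita connection `∇` it equals
`2 ⟪∇_Y X, Z⟫` at the point `x`. -/
def koszul (X Y Z : Π x : M, TangentSpace 𝓘(ℝ, E) x) (x : M) : ℝ :=
  mvfderiv 𝓘(ℝ, E) (fun y => inner ℝ (X y) (Z y)) x (Y x)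
    + mvfderiv 𝓘(ℝ, E) (fun y => inner ℝ (Y y) (Z y)) x (X x)
    - mvfderiv 𝓘(ℝ, E) (fun y => inner ℝ (Y y) (X y)) x (Z x)
    + inner ℝ (VectorField.mlieBracket 𝓘(ℝ, E) Y X x) (Z x)
    - inner ℝ (VectorField.mlieBracket 𝓘(ℝ, E) Y Z x) (X x)
    - inner ℝ (VectorField.mlieBracket 𝓘(ℝ, E) X Z x) (Y x)

variable [FiniteDimensional ℝ E] [IsManifold 𝓘(ℝ, E) ∞ M]
  [IsContMDiffRiemannianBundle 𝓘(ℝ, E) ∞ E (fun x : M => TangentSpace 𝓘(ℝ, E) x)]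

/-- The inner product of two differentiable vector fields is differentiable. -/
theorem mdifferentiableAt_inner {Y Z : Π x : M, TangentSpace 𝓘(ℝ, E) x} {x : M}
    (hY : MDiffAt (T% Y) x) (hZ : MDiffAt (T% Z) x) :
    MDiffAt (fun y => inner ℝ (Y y) (Z y)) x := by
  have : IsContMDiffRiemannianBundle 𝓘(ℝ, E) 1 E (fun x : M => TangentSpace 𝓘(ℝ, E) x) :=
    inferInstance
  exact MDifferentiableAt.inner_bundle (E := fun x : M => TangentSpace 𝓘(ℝ, E) x)
    (b := fun x => x) hY hZ

/-- In the direction argument `Y` the Koszul expression is tensorial. -/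
theorem koszul_tensorial_left {X Z : Π x : M, TangentSpace 𝓘(ℝ, E) x} {x : M}
    (hX : MDiffAt (T% X) x) (hZ : MDiffAt (T% Z) x) :
    TensorialAt 𝓘(ℝ, E) E (fun Y => koszul X Y Z x) x where
  smul {f Y} hf hY := by
    have h1 := mvfderiv_fun_mul hf (mdifferentiableAt_inner hY hZ)
    have h2 := mvfderiv_fun_mul hf (mdifferentiableAt_inner hY hX)
    simp [koszul, inner_smul_left, h1, h2, VectorField.mlieBracket_smul_left hf hY,
      inner_add_left, inner_smul_right]
    rw [real_inner_comm (Z x) (Y x), real_inner_comm (X x) (Y x)]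
    ring
  add {Y Y'} hY hY' := by
    have h1 := mvfderiv_fun_add (mdifferentiableAt_inner hY hZ) (mdifferentiableAt_inner hY' hZ)
    have h2 := mvfderiv_fun_add (mdifferentiableAt_inner hY hX) (mdifferentiableAt_inner hY' hX)
    simp [koszul, inner_add_left, h1, h2, VectorField.mlieBracket_add_left hY hY',
      inner_add_right]
    ring

/-- In the test argument `Z` the Koszul expression is tensorial. -/
theorem koszul_tensorial_right {X Y : Π x : M, TangentSpace 𝓘(ℝ, E) x} {x : M}
    (hX : MDiffAt (T% X) x) (hY : MDiffAt (T% Y) x) :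
    TensorialAt 𝓘(ℝ, E) E (fun Z => koszul X Y Z x) x where
  smul {f Z} hf hZ := by
    have h1 := mvfderiv_fun_mul hf (mdifferentiableAt_inner hX hZ)
    have h2 := mvfderiv_fun_mul hf (mdifferentiableAt_inner hY hZ)
    simp [koszul, inner_smul_right, h1, h2, VectorField.mlieBracket_smul_right hf hZ,
      inner_add_left, inner_smul_left]
    rw [real_inner_comm (Z x) (Y x), real_inner_comm (Z x) (X x)]
    ring
  add {Z Z'} hZ hZ' := by
    have h1 := mvfderiv_fun_add (mdifferentiableAt_inner hX hZ) (mdifferentiableAt_inner hX hZ')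
    have h2 := mvfderiv_fun_add (mdifferentiableAt_inner hY hZ) (mdifferentiableAt_inner hY hZ')
    simp [koszul, inner_add_right, h1, h2, VectorField.mlieBracket_add_right hZ hZ',
      inner_add_left]
    ring

open Classical in
/-- The covariant differential `Y₀ ↦ ∇_{Y₀} X` at `x` of the Levi-Civita connection, given by the
Koszul formula and the Riesz representation of linear forms on the tangent space. (It is `0`
by convention if `X` is not differentiable at `x`.) -/
def covariantDifferential (X : Π x : M, TangentSpace 𝓘(ℝ, E) x) (x : M) :
    TangentSpace 𝓘(ℝ, E) x →L[ℝ] TangentSpace 𝓘(ℝ, E) x :=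
  haveI : FiniteDimensional ℝ (TangentSpace 𝓘(ℝ, E) x) :=
    inferInstanceAs (FiniteDimensional ℝ E)
  haveI : CompleteSpace (TangentSpace 𝓘(ℝ, E) x) := FiniteDimensional.complete ℝ _
  if hX : MDiffAt (T% X) x then
    InnerProductSpace.continuousLinearMapOfBilin (𝕜 := ℝ)
      ((1 / 2 : ℝ) • TensorialAt.mkHom₂ (I := 𝓘(ℝ, E)) (F := E) (F' := E)
        (fun Y Z => koszul X Y Z x) x
        (fun _ hZ => koszul_tensorial_left hX hZ) (fun _ hY => koszul_tensorial_right hX hY))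
  else 0

theorem inner_covariantDifferential {X Y Z : Π x : M, TangentSpace 𝓘(ℝ, E) x} {x : M}
    (hX : MDiffAt (T% X) x) (hY : MDiffAt (T% Y) x) (hZ : MDiffAt (T% Z) x) :
    inner ℝ (covariantDifferential X x (Y x)) (Z x) = (1 / 2 : ℝ) * koszul X Y Z x := by
  have : FiniteDimensional ℝ (TangentSpace 𝓘(ℝ, E) x) :=
    inferInstanceAs (FiniteDimensional ℝ E)
  have : CompleteSpace (TangentSpace 𝓘(ℝ, E) x) := FiniteDimensional.complete ℝ _
  rw [covariantDifferential, dif_pos hX, InnerProductSpace.continuousLinearMapOfBilin_apply]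
  have := TensorialAt.mkHom₂_apply (I := 𝓘(ℝ, E)) (F := E) (F' := E)
        (Φ := fun Y Z => koszul X Y Z x) (x := x)
        (fun _ hZ => koszul_tensorial_left hX hZ) (fun _ hY => koszul_tensorial_right hX hY) hY hZ
  simp [← this]

/-- Endomorphisms of a tangent space are determined by the inner products `⟪A Y, Z⟫` with
differentiable vector fields `Y`, `Z`. -/
theorem covariantDifferential_ext
    {A B : Π x : M, TangentSpace 𝓘(ℝ, E) x →L[ℝ] TangentSpace 𝓘(ℝ, E) x} {x : M}
    (h : ∀ Y Z : Π x : M, TangentSpace 𝓘(ℝ, E) x, MDiffAt (T% Y) x → MDiffAt (T% Z) x →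
      inner ℝ (A x (Y x)) (Z x) = (inner ℝ (B x (Y x)) (Z x) : ℝ)) : A x = B x := by
  ext Y₀
  refine ext_inner_right ℝ fun Z₀ => ?_
  have := h (FiberBundle.extend E Y₀) (FiberBundle.extend E Z₀)
    (FiberBundle.mdifferentiableAt_extend ..) (FiberBundle.mdifferentiableAt_extend ..)
  simpa using this

/-- The Levi-Civita connection of the Riemannian manifold `M`. Here `leviCivita X x` is the
covariant differential `Y₀ ↦ ∇_{Y₀} X` at `x`. -/
def leviCivita : CovariantDerivative 𝓘(ℝ, E) E (fun x : M => TangentSpace 𝓘(ℝ, E) x) where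
  toFun := covariantDifferential
  isCovariantDerivativeOnUniv :=
    { add := fun {X X' x} hX hX' _ => by
        apply covariantDifferential_ext (A := covariantDifferential (X + X'))
          (B := covariantDifferential X + covariantDifferential X')
        intro Y Z hY hZ
        rw [inner_covariantDifferential (mdifferentiableAt_add_section hX hX') hY hZ]
        simp only [Pi.add_apply, _root_.add_apply, inner_add_left]
        rw [inner_covariantDifferential hX hY hZ, inner_covariantDifferential hX' hY hZ]
        have h1 := mvfderiv_fun_add (mdifferentiableAt_inner hX hZ) (mdifferentiableAt_inner hX' hZ)
        have h2 := mvfderiv_fun_add (mdifferentiableAt_inner hY hX) (mdifferentiableAt_inner hY hX')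
        simp [koszul, inner_add_left, inner_add_right, h1, h2,
          VectorField.mlieBracket_add_left hX hX', VectorField.mlieBracket_add_right hX hX']
        ring
      leibniz := fun {X f x} hX hf _ => by
        apply covariantDifferential_ext (A := covariantDifferential (f • X))
          (B := fun x => f x • covariantDifferential X x +
            (mvfderiv 𝓘(ℝ, E) f x).smulRight (X x))
        intro Y Z hY hZ
        rw [inner_covariantDifferential (hf.smul_section hX) hY hZ]
        simp only [_root_.add_apply, inner_add_left, _root_.smul_apply,
          inner_smul_left, ContinuousLinearMap.smulRight_apply]
        rw [inner_covariantDifferential hX hY hZ]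
        have h1 := mvfderiv_fun_mul hf (mdifferentiableAt_inner hX hZ)
        have h2 := mvfderiv_fun_mul hf (mdifferentiableAt_inner hY hX)
        simp [koszul, inner_smul_left, inner_smul_right, inner_add_left, h1, h2,
          VectorField.mlieBracket_smul_left hf hX, VectorField.mlieBracket_smul_right hf hX]
        rw [real_inner_comm (X x) (Y x)]
        ring }

/-- The Levi-Civita connection is compatible with the metric. -/
theorem leviCivita_metric {X Y Z : Π x : M, TangentSpace 𝓘(ℝ, E) x} {x : M}
    (hX : MDiffAt (T% X) x) (hY : MDiffAt (T% Y) x) (hZ : MDiffAt (T% Z) x) :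
    mvfderiv 𝓘(ℝ, E) (fun y => inner ℝ (X y) (Z y)) x (Y x) =
      inner ℝ (leviCivita X x (Y x)) (Z x) + inner ℝ (X x) (leviCivita Z x (Y x)) := by
  change _ = inner ℝ (covariantDifferential X x (Y x)) (Z x)
    + inner ℝ (X x) (covariantDifferential Z x (Y x))
  rw [real_inner_comm _ (X x), inner_covariantDifferential hX hY hZ,
    inner_covariantDifferential hZ hY hX]
  have h1 : VectorField.mlieBracket 𝓘(ℝ, E) Z X x = -VectorField.mlieBracket 𝓘(ℝ, E) X Z x :=
    VectorField.mlieBracket_swap_apply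
  have h2 : (fun y => inner ℝ (Z y) (X y)) = (fun y => (inner ℝ (X y) (Z y) : ℝ)) :=
    funext fun y => real_inner_comm _ _
  simp only [koszul, h1, h2, inner_neg_left]
  ring

/-- The Levi-Civita connection is torsion free. -/
theorem leviCivita_torsion :
    (leviCivita : CovariantDerivative 𝓘(ℝ, E) E
      (fun x : M => TangentSpace 𝓘(ℝ, E) x)).torsion = 0 := by
  rw [CovariantDerivative.torsion_eq_zero_iff]
  intro X Y x hX hY
  refine ext_inner_right ℝ fun Z₀ => ?_
  obtain ⟨Z, hZ, rfl⟩ : ∃ Z : Π x : M, TangentSpace 𝓘(ℝ, E) x, MDiffAt (T% Z) x ∧ Z x = Z₀ :=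
    ⟨FiberBundle.extend E Z₀, FiberBundle.mdifferentiableAt_extend .., by simp⟩
  change inner ℝ (covariantDifferential Y x (X x) - covariantDifferential X x (Y x)) (Z x) = _
  rw [inner_sub_left, inner_covariantDifferential hY hX hZ, inner_covariantDifferential hX hY hZ]
  have h1 : VectorField.mlieBracket 𝓘(ℝ, E) Y X x = -VectorField.mlieBracket 𝓘(ℝ, E) X Y x :=
    VectorField.mlieBracket_swap_apply
  have h2 : (fun y => inner ℝ (Y y) (X y)) = (fun y => (inner ℝ (X y) (Y y) : ℝ)) :=
    funext fun y => real_inner_comm _ _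
  simp only [koszul, h1, h2, inner_neg_left]
  ring

end LeviCivita

section Flow

variable {E : Type*} [NormedAddCommGroup E] [NormedSpace ℝ E]
  {M : Type*} [TopologicalSpace M] [ChartedSpace E M]

/-- `γ` is an integral curve of `X` starting at `x` on an open interval that contains both `0`
and `t`. -/
def IsFlowLine (X : Π x : M, TangentSpace 𝓘(ℝ, E) x) (t : ℝ) (x : M) (γ : ℝ → M) : Prop :=
  γ 0 = x ∧ ∃ a b : ℝ, 0 ∈ Ioo a b ∧ t ∈ Ioo a b ∧ IsMIntegralCurveOn γ X (Ioo a b)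

/-- The domain of the (maximal, local) flow of `X`. -/
def flowDomain (X : Π x : M, TangentSpace 𝓘(ℝ, E) x) : Set (ℝ × M) :=
  {z | ∃ γ : ℝ → M, IsFlowLine X z.1 z.2 γ}

open Classical in
/-- The flow of `X`: `flow X t x` is the value at time `t` of the integral curve of `X` starting
at `x`. (Outside the domain of the flow the value is irrelevant.) -/
noncomputable def flow (X : Π x : M, TangentSpace 𝓘(ℝ, E) x) (t : ℝ) (x : M) : M :=
  if h : ∃ γ : ℝ → M, IsFlowLine X t x γ then h.choose t else x

end Flow

/-! Since `d(p₀,q₀) = d_N(p₀,q₀)`, there are `C¹` curves `γ` in `N` from `p₀` to `q₀` whose length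
is arbitrarily close to `d(p₀,q₀)`. Transport such a curve by the flow. If `V(t)` is the velocity of
`s ↦ Fl_t(γ(s))` at a fixed `s`, then `d/dt |V|² = 2⟪∇_V X, V⟫ ≤ 2 C_T |V|²`, so Grönwall gives
`|V(t)| ≤ e^{C_T t} |V(0)|`. Integrating over `s` bounds the length of the transported curve, hence
the distance of its endpoints.

The derivative formula is proved in a chart. There `V` solves the variational equation
(`exists_localFlow_hasFDerivAt`), and `fderiv_chartNormSq` is the Koszul formula tested on a field
that is constant in the chart. This yields the bound for short times
(`exists_localFlow_norm_mfderiv_le`). A long time interval is split into finitely many short steps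
along one trajectory at a time (`contMDiffAt_flow_curve`). The exponential factors multiply, and the
`C¹` dependence on `s` is carried along, so smoothness of the global flow is never needed. -/

/-! ### Differentiable dependence on the initial value in a Banach space -/

open Metric in
/-- A `C²` vector field on a Banach space has a local flow which is differentiable with respect to
the initial point, the derivative being the solution of the variational equation. -/
theorem exists_localFlow_hasFDerivAt {E : Type*} [NormedAddCommGroup E] [NormedSpace ℝ E]
    [CompleteSpace E] {f : E → E} {y₀ : E} {Ω : Set E} (hf : ContDiffAt ℝ 2 f y₀)
    (hΩ : Ω ∈ 𝓝 y₀) :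
    ∃ (α : E → ℝ → E) (D : E → ℝ → E →L[ℝ] E) (W : Set E) (ε : ℝ), 0 < ε ∧ IsOpen W ∧ y₀ ∈ W ∧
      (∀ y ∈ W, α y 0 = y ∧ D y 0 = ContinuousLinearMap.id ℝ E) ∧
      (∀ y ∈ W, ∀ t ∈ Ioo (-ε) ε, α y t ∈ Ω ∧ HasDerivAt (α y) (f (α y t)) t ∧
        HasDerivAt (D y) ((fderiv ℝ f (α y t)).comp (D y t)) t) ∧
      ∀ t ∈ Ico 0 ε, (∀ y ∈ W, HasFDerivAt (α · t) (D y t) y) ∧ ContinuousOn (D · t) W := by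
  have hf1 : ContDiffAt ℝ 1 f y₀ := hf.of_le (by norm_num)
  have hdf : ContDiffAt ℝ 1 (fderiv ℝ f) y₀ := hf.fderiv_right (by norm_num)
  -- Couple the equation with its variational equation. As `f` is `C²`, the coupled field is `C¹`,
  -- and a single application of Picard–Lindelöf gives both `α` and `D`, continuous in the initial
  -- value.
  let F : E × (E →L[ℝ] E) → E × (E →L[ℝ] E) := fun p => (f p.1, (fderiv ℝ f p.1).comp p.2)
  let p₀ : E × (E →L[ℝ] E) := (y₀, ContinuousLinearMap.id ℝ E)
  have hF : ContDiffAt ℝ 1 F p₀ := by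
    have h1 : ContDiffAt ℝ 1 (fun p : E × (E →L[ℝ] E) => f p.1) p₀ :=
      ContDiffAt.comp p₀ (g := f) hf1 contDiffAt_fst
    have h2 : ContDiffAt ℝ 1 (fun p : E × (E →L[ℝ] E) => fderiv ℝ f p.1) p₀ :=
      ContDiffAt.comp p₀ (g := fderiv ℝ f) hdf contDiffAt_fst
    exact h1.prodMk (h2.clm_comp contDiffAt_snd)
  obtain ⟨ε₀, hε₀, a, r, L, K₀, hr, hPL⟩ := IsPicardLindelof.of_contDiffAt_one hF
  obtain ⟨γ, hγ, hγc⟩ := (hPL 0).exists_forall_mem_closedBall_eq_hasDerivWithinAt_continuousOn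
  simp only [zero_sub, zero_add] at hγ hγc
  -- a ball on which `f` and its derivative are Lipschitz
  obtain ⟨K, s₁, hs₁, hK⟩ := hf1.exists_lipschitzOnWith
  obtain ⟨A, s₂, hs₂, hA⟩ := hdf.exists_lipschitzOnWith
  have hdiff : ∀ᶠ y in 𝓝 y₀, DifferentiableAt ℝ f y := by
    filter_upwards [hf1.eventually (by norm_num)] with y hy using hy.differentiableAt one_ne_zero
  obtain ⟨ρ, hρ, hball⟩ := Metric.mem_nhds_iff.1
    (Filter.inter_mem (Filter.inter_mem hs₁ hs₂) (Filter.inter_mem hΩ hdiff))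
  have hKb : LipschitzOnWith K f (ball y₀ ρ) := hK.mono fun y hy => (hball hy).1.1
  have hAb : LipschitzOnWith A (fderiv ℝ f) (ball y₀ ρ) := hA.mono fun y hy => (hball hy).1.2
  have hdb : ∀ y ∈ ball y₀ ρ, DifferentiableAt ℝ f y := fun y hy => (hball hy).2.2
  -- the flow of the extended system stays close to its initial value
  have hnear : ∀ᶠ q : (E × (E →L[ℝ] E)) × ℝ in 𝓝 (p₀, 0),
      (γ q).1 ∈ ball y₀ (ρ / 2) ∧ (γ q).2 ∈ ball (ContinuousLinearMap.id ℝ E) 1 := by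
    have hc : ContinuousAt γ (p₀, 0) := hγc.continuousAt
      (prod_mem_nhds (closedBall_mem_nhds _ (by exact_mod_cast hr))
        (Icc_mem_nhds (by linarith) hε₀))
    have h0 : γ (p₀, 0) = p₀ := (hγ p₀ (mem_closedBall_self r.2)).1
    have : ball y₀ (ρ / 2) ×ˢ ball (ContinuousLinearMap.id ℝ E) 1 ∈ 𝓝 (γ (p₀, 0)) := by
      rw [h0]
      exact prod_mem_nhds (ball_mem_nhds _ (by linarith)) (ball_mem_nhds _ one_pos)
    exact hc.eventually_mem this
  obtain ⟨δ, hδ, hδb⟩ := Metric.mem_nhds_iff.1 hnear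
  let ε := min δ ε₀
  let W := ball y₀ (min δ r)
  let α : E → ℝ → E := fun y t => (γ ((y, ContinuousLinearMap.id ℝ E), t)).1
  let D : E → ℝ → E →L[ℝ] E := fun y t => (γ ((y, ContinuousLinearMap.id ℝ E), t)).2
  have hε : 0 < ε := lt_min hδ hε₀
  have hr' : (0 : ℝ) < r := by exact_mod_cast hr
  have hWr : ∀ y ∈ W, ((y, ContinuousLinearMap.id ℝ E) : E × (E →L[ℝ] E)) ∈ closedBall p₀ r := by
    intro y hy
    rw [mem_closedBall, Prod.dist_eq, max_le_iff]
    exact ⟨((mem_ball.1 hy).trans_le (min_le_right _ _)).le, by simp [p₀]⟩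
  have hst : ∀ y ∈ W, ∀ t ∈ Ioo (-ε) ε, α y t ∈ ball y₀ (ρ / 2) ∧ ‖D y t‖ ≤ 2 := by
    intro y hy t ht
    have h1 : ((y, ContinuousLinearMap.id ℝ E), t) ∈ ball (p₀, (0 : ℝ)) δ := by
      rw [mem_ball, Prod.dist_eq, Prod.dist_eq, max_lt_iff, max_lt_iff]
      refine ⟨⟨(mem_ball.1 hy).trans_le (min_le_left _ _), by simpa [p₀] using hδ⟩, ?_⟩
      simpa [abs_lt] using Ioo_subset_Ioo (neg_le_neg (min_le_left _ _)) (min_le_left _ _) ht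
    obtain ⟨h2, h3⟩ := hδb h1
    refine ⟨h2, ?_⟩
    have h4 : ‖D y t - ContinuousLinearMap.id ℝ E‖ < 1 := mem_ball_iff_norm.1 h3
    have h5 := norm_le_norm_sub_add (D y t) (ContinuousLinearMap.id ℝ E)
    have h6 : ‖ContinuousLinearMap.id ℝ E‖ ≤ 1 := ContinuousLinearMap.norm_id_le
    linarith
  have hder : ∀ y ∈ W, ∀ t ∈ Ioo (-ε) ε, HasDerivAt (α y) (f (α y t)) t ∧
      HasDerivAt (D y) ((fderiv ℝ f (α y t)).comp (D y t)) t := by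
    intro y hy t ht
    have ht' : t ∈ Ioo (-ε₀) ε₀ :=
      Ioo_subset_Ioo (neg_le_neg (min_le_right _ _)) (min_le_right _ _) ht
    have := ((hγ _ (hWr y hy)).2 t (Ioo_subset_Icc_self ht')).hasDerivAt
      (Icc_mem_nhds ht'.1 ht'.2)
    exact ⟨this.fst, this.snd⟩
  refine ⟨α, D, W, ε, hε, isOpen_ball, mem_ball_self (lt_min hδ hr'), ?_, ?_, ?_⟩
  · intro y hy
    have := (hγ _ (hWr y hy)).1
    exact ⟨congrArg Prod.fst this, congrArg Prod.snd this⟩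
  · intro y hy t ht
    exact ⟨(hball (ball_subset_ball (by linarith) (hst y hy t ht).1)).2.1, hder y hy t ht⟩
  intro t ht
  refine ⟨fun y hy => ?_, ?_⟩
  · -- compare the nearby solution with the linear approximation
    have hsub : ∀ τ ∈ Icc 0 t, τ ∈ Ioo (-ε) ε := fun τ hτ =>
      ⟨by linarith [hτ.1], hτ.2.trans_lt ht.2⟩
    have key : ∀ᶠ h in 𝓝 (0 : E), ‖α (y + h) t - α y t - D y t h‖ ≤
        gronwallBound 0 (K + 1) 1 t * (4 * A) * ‖h‖ ^ 2 := by
      have hW' : ∀ᶠ h in 𝓝 (0 : E), y + h ∈ W := by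
        have : Filter.Tendsto (fun h : E => y + h) (𝓝 0) (𝓝 y) :=
          (continuous_const_add y).tendsto' 0 y (by simp)
        exact this.eventually_mem (isOpen_ball.mem_nhds hy)
      -- With `‖D‖ ≤ 2` this gives `‖D h‖ < ρ / 2`, so the affine approximation stays in the ball of
      -- radius `ρ`, where the Lipschitz bounds hold.
      filter_upwards [hW', ball_mem_nhds (0 : E) (by positivity : (0 : ℝ) < ρ / 4)] with h hh hhρ
      have hhρ' : ‖h‖ < ρ / 4 := by simpa using hhρ
      have happ : ∀ τ ∈ Icc 0 t, ‖D y τ h‖ ≤ 2 * ‖h‖ := fun τ hτ =>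
        (D y τ).le_of_opNorm_le (hst y hy τ (hsub τ hτ)).2 h
      have hmem : ∀ τ ∈ Icc 0 t, α y τ + D y τ h ∈ ball y₀ ρ := by
        intro τ hτ
        have h1 := mem_ball_iff_norm.1 (hst y hy τ (hsub τ hτ)).1
        rw [mem_ball_iff_norm]
        have h2 : ‖α y τ + D y τ h - y₀‖ ≤ ‖α y τ - y₀‖ + ‖D y τ h‖ := by
          rw [add_sub_right_comm]; exact norm_add_le _ _
        linarith [happ τ hτ]
      have hgd : ∀ τ ∈ Icc 0 t, HasDerivAt (fun τ => α y τ + D y τ h)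
          (f (α y τ) + fderiv ℝ f (α y τ) (D y τ h)) τ := by
        intro τ hτ
        obtain ⟨h1, h2⟩ := hder y hy τ (hsub τ hτ)
        refine h1.add ?_
        simpa using h2.clm_apply (hasDerivAt_const τ h)
      -- The affine approximation solves the equation up to an error `4 A ‖h‖²`. Using `K + 1`
      -- instead of `K` keeps the Lipschitz constant nonzero, and in that case `gronwallBound` with
      -- zero initial gap is visibly linear in the error.
      have := dist_le_of_approx_trajectories_ODE_of_mem (v := fun _ => f) (s := fun _ => ball y₀ ρ)
        (K := K + 1) (a := 0) (b := t) (f := α (y + h)) (f' := fun τ => f (α (y + h) τ))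
        (g := fun τ => α y τ + D y τ h)
        (g' := fun τ => f (α y τ) + fderiv ℝ f (α y τ) (D y τ h)) (εf := 0)
        (εg := 4 * A * ‖h‖ ^ 2) (δ := 0)
        (fun _ _ => hKb.weaken (by simp))
        (fun τ hτ => (hder _ hh τ (hsub τ hτ)).1.continuousAt.continuousWithinAt)
        (fun τ hτ => (hder _ hh τ (hsub τ (Ico_subset_Icc_self hτ))).1.hasDerivWithinAt)
        (fun τ hτ => by simp)
        (fun τ hτ => ball_subset_ball (by linarith)
          (hst _ hh τ (hsub τ (Ico_subset_Icc_self hτ))).1)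
        (fun τ hτ => (hgd τ hτ).continuousAt.continuousWithinAt)
        (fun τ hτ => (hgd τ (Ico_subset_Icc_self hτ)).hasDerivWithinAt)
        (fun τ hτ => ?_)
        (fun τ hτ => hmem τ (Ico_subset_Icc_self hτ))
        (by
          have h1 := (hγ _ (hWr y hy)).1
          have h2 := (hγ _ (hWr _ hh)).1
          simp [α, D, h1, h2]) t ⟨ht.1, le_rfl⟩
      · rw [dist_eq_norm, ← sub_sub] at this
        refine this.trans_eq ?_
        have hK1 : ((K + 1 : NNReal) : ℝ) ≠ 0 := by positivity
        have hK2 : (K + 1 : ℝ) ≠ 0 := by positivity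
        rw [gronwallBound_of_K_ne_0 hK1, gronwallBound_of_K_ne_0 hK2]
        push_cast
        simp only [sub_zero]
        ring
      · have hτ' := Ico_subset_Icc_self hτ
        have hαm : α y τ ∈ ball y₀ ρ :=
          ball_subset_ball (by linarith) (hst y hy τ (hsub τ hτ')).1
        have hseg := (convex_ball y₀ ρ).segment_subset hαm (hmem τ hτ')
        -- First-order Taylor remainder: on the segment, `fderiv ℝ f` varies by at most `A ‖D h‖`.
        have := Convex.norm_image_sub_le_of_norm_fderiv_le' (𝕜 := ℝ) (f := f)
          (φ := fderiv ℝ f (α y τ)) (C := A * ‖D y τ h‖)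
          (s := segment ℝ (α y τ) (α y τ + D y τ h))
          (x := α y τ) (y := α y τ + D y τ h)
          (fun x hx => hdb x (hseg hx))
          (fun x hx => by
            refine (hAb.norm_sub_le (hseg hx) hαm).trans ?_
            gcongr
            simpa using norm_sub_le_of_mem_segment hx)
          (convex_segment _ _) (left_mem_segment _ _ _) (right_mem_segment _ _ _)
        rw [add_sub_cancel_left] at this
        rw [dist_comm, dist_eq_norm, ← sub_sub]
        refine this.trans ?_
        have h1 := happ τ hτ'
        calc (A : ℝ) * ‖D y τ h‖ * ‖D y τ h‖ ≤ A * (2 * ‖h‖) * (2 * ‖h‖) := by gcongr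
          _ = 4 * A * ‖h‖ ^ 2 := by ring
    rw [hasFDerivAt_iff_isLittleO_nhds_zero]
    have hO : (fun h => α (y + h) t - α y t - D y t h) =O[𝓝 0] fun h : E => ‖h‖ ^ 2 :=
      Asymptotics.IsBigO.of_bound _ (key.mono fun h hh => by simpa using hh)
    exact hO.trans_isLittleO (Asymptotics.isLittleO_norm_pow_id one_lt_two)
  · have h1 : ContinuousOn (fun y => γ ((y, ContinuousLinearMap.id ℝ E), t)) W := by
      refine hγc.comp (by fun_prop) fun y hy => ⟨hWr y hy, ?_⟩
      have : ε ≤ ε₀ := min_le_right _ _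
      exact ⟨by linarith [ht.1], by linarith [ht.2]⟩
    exact continuous_snd.comp_continuousOn h1

/-! ### Vector fields and Lie brackets in a chart -/

section ChartFlow

variable {E : Type*} [NormedAddCommGroup E] [NormedSpace ℝ E]
  {M : Type*} [TopologicalSpace M] [ChartedSpace E M] [IsManifold 𝓘(ℝ, E) ∞ M]

theorem contMDiffAt_extChartAt_symm (z₀ : M) {y : E} (hy : y ∈ (extChartAt 𝓘(ℝ, E) z₀).target) :
    ContMDiffAt 𝓘(ℝ, E) 𝓘(ℝ, E) ∞ (extChartAt 𝓘(ℝ, E) z₀).symm y :=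
  (contMDiffOn_extChartAt_symm z₀).contMDiffAt ((isOpen_extChartAt_target z₀).mem_nhds hy)

theorem mfderiv_extChartAt_comp_mfderiv_symm (z₀ : M) {y : E}
    (hy : y ∈ (extChartAt 𝓘(ℝ, E) z₀).target) :
    (mfderiv 𝓘(ℝ, E) 𝓘(ℝ, E) (extChartAt 𝓘(ℝ, E) z₀) ((extChartAt 𝓘(ℝ, E) z₀).symm y)).comp
      (mfderiv 𝓘(ℝ, E) 𝓘(ℝ, E) (extChartAt 𝓘(ℝ, E) z₀).symm y) = ContinuousLinearMap.id ℝ _ := by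
  have : IsManifold 𝓘(ℝ, E) 1 M := inferInstance
  have := mfderiv_extChartAt_comp_mfderivWithin_extChartAt_symm (I := 𝓘(ℝ, E)) hy
  simpa using this

theorem mfderiv_symm_comp_mfderiv_extChartAt (z₀ : M) {y : E}
    (hy : y ∈ (extChartAt 𝓘(ℝ, E) z₀).target) :
    (mfderiv 𝓘(ℝ, E) 𝓘(ℝ, E) (extChartAt 𝓘(ℝ, E) z₀).symm y).comp
      (mfderiv 𝓘(ℝ, E) 𝓘(ℝ, E) (extChartAt 𝓘(ℝ, E) z₀) ((extChartAt 𝓘(ℝ, E) z₀).symm y)) =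
      ContinuousLinearMap.id ℝ _ := by
  have : IsManifold 𝓘(ℝ, E) 1 M := inferInstance
  have := mfderivWithin_extChartAt_symm_comp_mfderiv_extChartAt (I := 𝓘(ℝ, E)) hy
  simpa using this

theorem isInvertible_mfderiv_extChartAt_symm (z₀ : M) {y : E}
    (hy : y ∈ (extChartAt 𝓘(ℝ, E) z₀).target) :
    (mfderiv 𝓘(ℝ, E) 𝓘(ℝ, E) (extChartAt 𝓘(ℝ, E) z₀).symm y).IsInvertible :=
  .of_inverse (mfderiv_symm_comp_mfderiv_extChartAt z₀ hy)
    (mfderiv_extChartAt_comp_mfderiv_symm z₀ hy)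

/-- The vector field that is constant, with value `v`, in the chart at `z₀`. -/
noncomputable def chartConst (z₀ : M) (v : E) : Π x : M, TangentSpace 𝓘(ℝ, E) x :=
  VectorField.mpullback 𝓘(ℝ, E) 𝓘(ℝ, E) (extChartAt 𝓘(ℝ, E) z₀)
    (fun y => (v : TangentSpace 𝓘(ℝ, E) y))

theorem chartConst_symm (z₀ : M) {y : E} (hy : y ∈ (extChartAt 𝓘(ℝ, E) z₀).target) (v : E) :
    chartConst z₀ v ((extChartAt 𝓘(ℝ, E) z₀).symm y) =
      mfderiv 𝓘(ℝ, E) 𝓘(ℝ, E) (extChartAt 𝓘(ℝ, E) z₀).symm y v := by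
  exact DFunLike.congr_fun (ContinuousLinearMap.inverse_eq
    (mfderiv_extChartAt_comp_mfderiv_symm z₀ hy) (mfderiv_symm_comp_mfderiv_extChartAt z₀ hy)) v

theorem mdifferentiableAt_chartConst [CompleteSpace E] (z₀ : M) {y : E}
    (hy : y ∈ (extChartAt 𝓘(ℝ, E) z₀).target) (v : E) :
    MDiffAt (T% (chartConst z₀ v)) ((extChartAt 𝓘(ℝ, E) z₀).symm y) := by
  have : IsManifold 𝓘(ℝ, E) 2 M := inferInstance
  refine MDifferentiableAt.mpullback_vectorField (n := 2) ?_ ?_ ?_ le_rfl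
  · exact (contMDiffAt_vectorSpace_iff_contDiffAt.2
      (contDiffAt_const (n := 1) (c := v))).mdifferentiableAt one_ne_zero
  · refine contMDiffAt_extChartAt' ?_
    simpa using (extChartAt 𝓘(ℝ, E) z₀).map_target hy
  · exact .of_inverse (mfderiv_extChartAt_comp_mfderiv_symm z₀ hy)
      (mfderiv_symm_comp_mfderiv_extChartAt z₀ hy)

/-- The expression of the vector field `X` in the chart at `z₀`. -/
noncomputable def chartField (X : Π x : M, TangentSpace 𝓘(ℝ, E) x) (z₀ : M) (y : E) : E :=
  VectorField.mpullback 𝓘(ℝ, E) 𝓘(ℝ, E) (extChartAt 𝓘(ℝ, E) z₀).symm X y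

theorem mfderiv_chartField (X : Π x : M, TangentSpace 𝓘(ℝ, E) x) (z₀ : M) {y : E}
    (hy : y ∈ (extChartAt 𝓘(ℝ, E) z₀).target) :
    mfderiv 𝓘(ℝ, E) 𝓘(ℝ, E) (extChartAt 𝓘(ℝ, E) z₀).symm y (chartField (E := E) X z₀ y) =
      X ((extChartAt 𝓘(ℝ, E) z₀).symm y) :=
  ((isInvertible_mfderiv_extChartAt_symm z₀ hy).inverse_apply_eq.1 rfl).symm

theorem contDiffAt_chartField [CompleteSpace E] {X : Π x : M, TangentSpace 𝓘(ℝ, E) x}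
    (hX : ContMDiff 𝓘(ℝ, E) 𝓘(ℝ, E).tangent ∞ (fun x => (X x : TangentBundle 𝓘(ℝ, E) M)))
    (z₀ : M) {y : E} (hy : y ∈ (extChartAt 𝓘(ℝ, E) z₀).target) :
    ContDiffAt ℝ ∞ (chartField X z₀) y := by
  have : IsManifold 𝓘(ℝ, E) 1 M := inferInstance
  refine contMDiffAt_vectorSpace_iff_contDiffAt.1 ?_
  exact ContMDiffAt.mpullback_vectorField_preimage (n := ∞) (hX _)
    (contMDiffAt_extChartAt_symm z₀ hy) (isInvertible_mfderiv_extChartAt_symm z₀ hy) (by simp)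

/-- The Lie bracket of a constant vector field in a chart with `X`. -/
theorem mlieBracket_chartConst [CompleteSpace E] {X : Π x : M, TangentSpace 𝓘(ℝ, E) x}
    (hX : ContMDiff 𝓘(ℝ, E) 𝓘(ℝ, E).tangent ∞ (fun x => (X x : TangentBundle 𝓘(ℝ, E) M)))
    (z₀ : M) {y : E} (hy : y ∈ (extChartAt 𝓘(ℝ, E) z₀).target) (v : E) :
    VectorField.mlieBracket 𝓘(ℝ, E) (chartConst z₀ v) X ((extChartAt 𝓘(ℝ, E) z₀).symm y) =
      mfderiv 𝓘(ℝ, E) 𝓘(ℝ, E) (extChartAt 𝓘(ℝ, E) z₀).symm y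
        (fderiv ℝ (chartField X z₀) y v) := by
  have : IsManifold 𝓘(ℝ, E) (minSmoothness ℝ 2) M := by
    rw [minSmoothness_of_isRCLikeNormedField]; infer_instance
  -- Brackets commute with pullback, so it suffices to compute in `E`. There the first field is
  -- constant and only the derivative of `chartField` survives.
  have h1 := VectorField.mpullback_mlieBracket (n := ∞) (I := 𝓘(ℝ, E)) (I' := 𝓘(ℝ, E))
    (mdifferentiableAt_chartConst z₀ hy v)
    ((hX ((extChartAt 𝓘(ℝ, E) z₀).symm y)).mdifferentiableAt (by simp))
    (contMDiffAt_extChartAt_symm z₀ hy)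
    (by rw [minSmoothness_of_isRCLikeNormedField]; exact WithTop.coe_le_coe.2 le_top)
  have h2 : VectorField.mpullback 𝓘(ℝ, E) 𝓘(ℝ, E) (extChartAt 𝓘(ℝ, E) z₀).symm
      (chartConst z₀ v) =ᶠ[𝓝 y] (fun _ => v : E → E) := by
    filter_upwards [(isOpen_extChartAt_target z₀).mem_nhds hy] with y' hy'
    rw [VectorField.mpullback_apply, chartConst_symm z₀ hy']
    exact (isInvertible_mfderiv_extChartAt_symm z₀ hy').inverse_apply_eq.2 rfl
  have h3 : VectorField.mlieBracket 𝓘(ℝ, E)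
      (VectorField.mpullback 𝓘(ℝ, E) 𝓘(ℝ, E) (extChartAt 𝓘(ℝ, E) z₀).symm (chartConst z₀ v))
      (VectorField.mpullback 𝓘(ℝ, E) 𝓘(ℝ, E) (extChartAt 𝓘(ℝ, E) z₀).symm X) y =
      fderiv ℝ (chartField X z₀) y v := by
    refine (h2.mlieBracket_vectorField_eq .rfl).trans ?_
    refine (congrFun VectorField.mlieBracketWithin_univ.symm y).trans ?_
    refine (congrFun VectorField.mlieBracketWithin_eq_lieBracketWithin y).trans ?_
    refine (congrFun VectorField.lieBracketWithin_univ y).trans ?_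
    change fderiv ℝ (chartField X z₀) y v - fderiv ℝ (fun _ : E => v) y _ = _
    have h4 : fderiv ℝ (fun _ : E => v) y = 0 := by simp
    rw [h4]
    exact sub_zero _
  exact (isInvertible_mfderiv_extChartAt_symm z₀ hy).inverse_apply_eq.1 (h1.trans h3)

end ChartFlow

/-! ### The Riemannian norm in a chart and its derivative along the variational flow -/

section ChartMetric

variable {E : Type*} [NormedAddCommGroup E] [NormedSpace ℝ E]
  {M : Type*} [TopologicalSpace M] [ChartedSpace E M]

/-- The tangent vector whose coordinates in the chart at `z₀` are `p`. -/
noncomputable def chartTangent (z₀ : M) (p : E × E) :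
    TangentSpace 𝓘(ℝ, E) ((extChartAt 𝓘(ℝ, E) z₀).symm p.1) :=
  mfderiv 𝓘(ℝ, E) 𝓘(ℝ, E) (extChartAt 𝓘(ℝ, E) z₀).symm p.1 p.2

/-- This is the tangent map of the inverse chart, read on `E × E`. Joint regularity is needed
because base point and vector both move with the flow. -/
theorem contMDiffAt_chartTangent [IsManifold 𝓘(ℝ, E) ∞ M] (z₀ : M) {p : E × E}
    (hp : p.1 ∈ (extChartAt 𝓘(ℝ, E) z₀).target) :
    ContMDiffAt 𝓘(ℝ, E × E) 𝓘(ℝ, E).tangent 1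
      (fun p => (⟨_, chartTangent z₀ p⟩ : TangentBundle 𝓘(ℝ, E) M)) p := by
  have : IsManifold 𝓘(ℝ, E) 1 M := inferInstance
  have hopen := isOpen_extChartAt_target (I := 𝓘(ℝ, E)) z₀
  have h1 : ContMDiffOn 𝓘(ℝ, E).tangent 𝓘(ℝ, E).tangent 1
      (tangentMapWithin 𝓘(ℝ, E) 𝓘(ℝ, E) (extChartAt 𝓘(ℝ, E) z₀).symm
        (extChartAt 𝓘(ℝ, E) z₀).target) (TotalSpace.proj ⁻¹' (extChartAt 𝓘(ℝ, E) z₀).target) :=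
    (contMDiffOn_extChartAt_symm (n := ∞) z₀).contMDiffOn_tangentMapWithin
      (WithTop.coe_le_coe.2 le_top) hopen.uniqueMDiffOn
  have h2 : ContMDiff 𝓘(ℝ, E × E) 𝓘(ℝ, E).tangent 1
      (fun p : E × E => (⟨p.1, p.2⟩ : TangentBundle 𝓘(ℝ, E) E)) := by
    intro q
    rw [contMDiffAt_totalSpace]
    refine ⟨contDiff_fst.contMDiff q, ?_⟩
    simpa using contDiff_snd.contMDiff q
  have h3 : ContMDiffAt 𝓘(ℝ, E × E) 𝓘(ℝ, E).tangent 1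
      (tangentMapWithin 𝓘(ℝ, E) 𝓘(ℝ, E) (extChartAt 𝓘(ℝ, E) z₀).symm
        (extChartAt 𝓘(ℝ, E) z₀).target ∘
        (fun p : E × E => (⟨p.1, p.2⟩ : TangentBundle 𝓘(ℝ, E) E))) p := by
    refine ContMDiffAt.comp p (h1.contMDiffAt ?_) (h2 p)
    exact (hopen.preimage (FiberBundle.continuous_proj E _)).mem_nhds hp
  refine h3.congr_of_eventuallyEq ?_
  filter_upwards [(hopen.preimage continuous_fst).mem_nhds hp] with q hq
  simp only [Function.comp_apply, tangentMapWithin, chartTangent]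
  rw [mfderivWithin_of_isOpen hopen hq]

variable [RiemannianBundle (fun x : M => TangentSpace 𝓘(ℝ, E) x)]

/-- The square of the Riemannian norm in the chart at `z₀`. -/
noncomputable def chartNormSq (z₀ : M) (p : E × E) : ℝ :=
  inner ℝ (chartTangent z₀ p) (chartTangent z₀ p)

variable [FiniteDimensional ℝ E] [IsManifold 𝓘(ℝ, E) ∞ M]
  [IsContMDiffRiemannianBundle 𝓘(ℝ, E) ∞ E (fun x : M => TangentSpace 𝓘(ℝ, E) x)]

omit [FiniteDimensional ℝ E] in
theorem differentiableAt_chartNormSq (z₀ : M) {p : E × E}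
    (hp : p.1 ∈ (extChartAt 𝓘(ℝ, E) z₀).target) :
    DifferentiableAt ℝ (chartNormSq z₀) p := by
  have : IsContMDiffRiemannianBundle 𝓘(ℝ, E) 1 E (fun x : M => TangentSpace 𝓘(ℝ, E) x) :=
    inferInstance
  have h := (contMDiffAt_chartTangent z₀ hp).mdifferentiableAt one_ne_zero
  have : MDifferentiableAt 𝓘(ℝ, E × E) 𝓘(ℝ, ℝ)
      (fun p => (inner ℝ (chartTangent z₀ p) (chartTangent z₀ p) : ℝ)) p := by
    refine MDifferentiableAt.inner_bundle (IB := 𝓘(ℝ, E)) (F := E)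
      (E := fun x : M => TangentSpace 𝓘(ℝ, E) x)
      (b := fun p : E × E => (extChartAt 𝓘(ℝ, E) z₀).symm p.1) ?_ ?_ <;> exact h
  exact this.differentiableAt

/-- Set `Z = Y` in the Koszul formula: the derivatives of `⟪X, Y⟫` cancel, `[Y, Y] = 0`, and the two
remaining brackets coincide. -/
theorem inner_leviCivita_self {X Y : Π x : M, TangentSpace 𝓘(ℝ, E) x} {x : M}
    (hX : MDiffAt (T% X) x) (hY : MDiffAt (T% Y) x) :
    2 * inner ℝ (leviCivita X x (Y x)) (Y x) =
      mvfderiv 𝓘(ℝ, E) (fun y => inner ℝ (Y y) (Y y)) x (X x) +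
        2 * inner ℝ (VectorField.mlieBracket 𝓘(ℝ, E) Y X x) (Y x) := by
  change 2 * inner ℝ (covariantDifferential X x (Y x)) (Y x) = _
  rw [inner_covariantDifferential hX hY hY]
  have h1 : VectorField.mlieBracket 𝓘(ℝ, E) X Y x = -VectorField.mlieBracket 𝓘(ℝ, E) Y X x :=
    VectorField.mlieBracket_swap_apply
  have h2 : (fun y => inner ℝ (Y y) (X y)) = (fun y => (inner ℝ (X y) (Y y) : ℝ)) :=
    funext fun y => real_inner_comm _ _
  simp only [koszul, h1, h2, VectorField.mlieBracket_self, Pi.zero_apply, inner_neg_left,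
    inner_zero_left]
  ring

/-- Apply `inner_leviCivita_self` with `Y` constant equal to `v` in the chart. The term `X⟪Y, Y⟫` is
the derivative in the base point, and the bracket term is the derivative in the fibre. -/
theorem fderiv_chartNormSq {X : Π x : M, TangentSpace 𝓘(ℝ, E) x}
    (hX : ContMDiff 𝓘(ℝ, E) 𝓘(ℝ, E).tangent ∞ (fun x => (X x : TangentBundle 𝓘(ℝ, E) M)))
    (z₀ : M) {y : E} (hy : y ∈ (extChartAt 𝓘(ℝ, E) z₀).target) (v : E) :
    fderiv ℝ (chartNormSq z₀) (y, v) (chartField X z₀ y, fderiv ℝ (chartField X z₀) y v) =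
      2 * inner ℝ (leviCivita X ((extChartAt 𝓘(ℝ, E) z₀).symm y) (chartTangent z₀ (y, v)))
        (chartTangent z₀ (y, v)) := by
  have : CompleteSpace E := FiniteDimensional.complete ℝ E
  have hYd := mdifferentiableAt_chartConst z₀ hy v
  have hY : chartConst z₀ v ((extChartAt 𝓘(ℝ, E) z₀).symm y) = chartTangent z₀ (y, v) :=
    chartConst_symm z₀ hy v
  have hσ : MDifferentiableAt 𝓘(ℝ, E) 𝓘(ℝ, E) (extChartAt 𝓘(ℝ, E) z₀).symm y :=
    (contMDiffAt_extChartAt_symm z₀ hy).mdifferentiableAt (by simp)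
  have hG := (differentiableAt_chartNormSq (p := (y, v)) z₀ hy).hasFDerivAt
  rw [← hY, inner_leviCivita_self ((hX _).mdifferentiableAt (by simp)) hYd,
    mlieBracket_chartConst hX z₀ hy, hY]
  have hsplit : ((chartField X z₀ y, fderiv ℝ (chartField X z₀) y v) : E × E) =
      (chartField X z₀ y, 0) + (0, fderiv ℝ (chartField X z₀) y v) := by simp
  rw [hsplit, map_add]
  congr 1
  · -- derivative with respect to the base point
    have h1 : HasFDerivAt (fun y' => chartNormSq z₀ (y', v))
        ((fderiv ℝ (chartNormSq z₀) (y, v)).comp (ContinuousLinearMap.inl ℝ E E)) y :=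
      HasFDerivAt.comp (f := fun y' => (y', v)) y hG (hasFDerivAt_prodMk_left y v)
    have h2 : MDifferentiableAt 𝓘(ℝ, E) 𝓘(ℝ, ℝ)
        (fun x => (inner ℝ (chartConst z₀ v x) (chartConst z₀ v x) : ℝ))
        ((extChartAt 𝓘(ℝ, E) z₀).symm y) := mdifferentiableAt_inner hYd hYd
    let B : E →L[ℝ] ℝ := (mfderiv 𝓘(ℝ, E) 𝓘(ℝ, ℝ)
        (fun x => (inner ℝ (chartConst z₀ v x) (chartConst z₀ v x) : ℝ))
        ((extChartAt 𝓘(ℝ, E) z₀).symm y)).comp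
      (mfderiv 𝓘(ℝ, E) 𝓘(ℝ, E) (extChartAt 𝓘(ℝ, E) z₀).symm y)
    have h3 := (h2.hasMFDerivAt.comp y hσ.hasMFDerivAt).congr_of_eventuallyEq
      (f₁ := fun y' => chartNormSq z₀ (y', v)) (by
        filter_upwards [(isOpen_extChartAt_target z₀).mem_nhds hy] with y' hy'
        simp only [Function.comp_apply, chartConst_symm z₀ hy']
        rfl)
    have h4 : HasFDerivAt (fun y' => chartNormSq z₀ (y', v)) B y := h3.hasFDerivAt
    have h5 := DFunLike.congr_fun (h4.unique h1) (chartField X z₀ y)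
    refine h5.symm.trans ?_
    rw [← mfderiv_chartField X z₀ hy]
    rfl
  -- Over a fixed base point the function is a quadratic form in the fibre variable.
  · have h1 : HasFDerivAt (fun v' => chartNormSq z₀ (y, v'))
        ((fderiv ℝ (chartNormSq z₀) (y, v)).comp (ContinuousLinearMap.inr ℝ E E)) v :=
      HasFDerivAt.comp (f := fun v' => (y, v')) v hG (hasFDerivAt_prodMk_right y v)
    let A : E →L[ℝ] TangentSpace 𝓘(ℝ, E) ((extChartAt 𝓘(ℝ, E) z₀).symm y) :=
      mfderiv 𝓘(ℝ, E) 𝓘(ℝ, E) (extChartAt 𝓘(ℝ, E) z₀).symm y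
    have h2 : HasFDerivAt (fun v' => (inner ℝ (A v') (A v') : ℝ)) _ v :=
      A.hasFDerivAt.inner ℝ A.hasFDerivAt
    have h3 := DFunLike.congr_fun (h1.unique h2) (fderiv ℝ (chartField X z₀) y v)
    refine Eq.trans ?_ (h3.trans ?_)
    · simp
    · simp only [fderivInnerCLM_apply, ContinuousLinearMap.comp_apply,
        ContinuousLinearMap.prod_apply]
      rw [real_inner_comm, ← two_mul]
      rfl

theorem fderiv_chartNormSq_le {X : Π x : M, TangentSpace 𝓘(ℝ, E) x}
    (hX : ContMDiff 𝓘(ℝ, E) 𝓘(ℝ, E).tangent ∞ (fun x => (X x : TangentBundle 𝓘(ℝ, E) M)))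
    (z₀ : M) {y : E} (hy : y ∈ (extChartAt 𝓘(ℝ, E) z₀).target) (v : E) {C : ℝ}
    (hC : ‖leviCivita X ((extChartAt 𝓘(ℝ, E) z₀).symm y)‖ ≤ C) :
    fderiv ℝ (chartNormSq z₀) (y, v) (chartField X z₀ y, fderiv ℝ (chartField X z₀) y v) ≤
      2 * C * chartNormSq z₀ (y, v) := by
  rw [fderiv_chartNormSq hX z₀ hy, mul_assoc]
  gcongr
  refine (real_inner_le_norm _ _).trans ?_
  rw [chartNormSq, real_inner_self_eq_norm_mul_norm, ← mul_assoc]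
  gcongr
  exact (leviCivita X _).le_of_opNorm_le hC _

end ChartMetric

theorem le_mul_exp_of_hasDerivAt_le {φ φ' : ℝ → ℝ} {K t : ℝ} (ht : 0 ≤ t)
    (hφ : ∀ τ ∈ Icc 0 t, HasDerivAt φ (φ' τ) τ) (hle : ∀ τ ∈ Icc 0 t, φ' τ ≤ K * φ τ) :
    φ t ≤ φ 0 * Real.exp (K * t) := by
  have := le_gronwallBound_of_liminf_deriv_right_le (f := φ) (f' := φ') (δ := φ 0) (K := K)
    (ε := 0) (a := 0) (b := t) (fun τ hτ => (hφ τ hτ).continuousAt.continuousWithinAt)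
    (fun τ hτ r hr => (hφ τ (Ico_subset_Icc_self hτ)).hasDerivWithinAt.liminf_right_slope_le hr)
    le_rfl (fun τ hτ => by simpa using hle τ (Ico_subset_Icc_self hτ)) t ⟨ht, le_rfl⟩
  simpa [gronwallBound_ε0] using this

/-! ### Local flow on the manifold and growth of its differential -/

section LocalFlow

variable {E : Type*} [NormedAddCommGroup E] [NormedSpace ℝ E] [FiniteDimensional ℝ E]
  {M : Type*} [TopologicalSpace M] [ChartedSpace E M] [IsManifold 𝓘(ℝ, E) ∞ M]
  [RiemannianBundle (fun x : M => TangentSpace 𝓘(ℝ, E) x)]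
  [IsContMDiffRiemannianBundle 𝓘(ℝ, E) ∞ E (fun x : M => TangentSpace 𝓘(ℝ, E) x)]

omit [FiniteDimensional ℝ E]
  [IsContMDiffRiemannianBundle 𝓘(ℝ, E) ∞ E (fun x : M => TangentSpace 𝓘(ℝ, E) x)] in
theorem chartNormSq_mfderiv_extChartAt (z₀ : M) {z : M}
    (hz : z ∈ (extChartAt 𝓘(ℝ, E) z₀).source) (V : TangentSpace 𝓘(ℝ, E) z) :
    chartNormSq z₀ ((extChartAt 𝓘(ℝ, E) z₀ z,
      mfderiv 𝓘(ℝ, E) 𝓘(ℝ, E) (extChartAt 𝓘(ℝ, E) z₀) z V) : E × E) = ‖V‖ ^ 2 := by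
  obtain ⟨y, hy, rfl⟩ : ∃ y ∈ (extChartAt 𝓘(ℝ, E) z₀).target,
      (extChartAt 𝓘(ℝ, E) z₀).symm y = z :=
    ⟨_, (extChartAt 𝓘(ℝ, E) z₀).map_source hz, (extChartAt 𝓘(ℝ, E) z₀).left_inv hz⟩
  have h1 : chartTangent z₀ (y, (mfderiv 𝓘(ℝ, E) 𝓘(ℝ, E) (extChartAt 𝓘(ℝ, E) z₀)
      ((extChartAt 𝓘(ℝ, E) z₀).symm y) V : E)) = V :=
    DFunLike.congr_fun (mfderiv_symm_comp_mfderiv_extChartAt z₀ hy) V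
  -- The type of `chartTangent` depends on the base point, so the base point is generalized before
  -- substituting.
  have h2 : ∀ y' : E, y' = y → ∀ w : E, chartNormSq z₀ (y', w) = chartNormSq z₀ (y, w) := by
    rintro y' rfl w; rfl
  refine (h2 _ ((extChartAt 𝓘(ℝ, E) z₀).right_inv hy) _).trans ?_
  rw [chartNormSq, h1, real_inner_self_eq_norm_sq]

/-- In the chart the image of `V` solves the variational equation, so its squared norm satisfies
Grönwall's inequality with constant `2 C`. The bound `C` is asked only along the trajectory of `z`:
in the application `∇X` is controlled on the flow-out of `N`, which need not be open in `M`. -/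
theorem exists_localFlow_norm_mfderiv_le {X : Π x : M, TangentSpace 𝓘(ℝ, E) x}
    (hX : ContMDiff 𝓘(ℝ, E) 𝓘(ℝ, E).tangent ∞ (fun x => (X x : TangentBundle 𝓘(ℝ, E) M)))
    (z₀ : M) :
    ∃ (Ψ : ℝ → M → M) (U : Set M) (ε : ℝ), 0 < ε ∧ IsOpen U ∧ z₀ ∈ U ∧
      (∀ z ∈ U, Ψ 0 z = z ∧ IsMIntegralCurveOn (fun t => Ψ t z) X (Ioo (-ε) ε)) ∧
      ∀ t ∈ Ico 0 ε, ∀ z ∈ U, ContMDiffAt 𝓘(ℝ, E) 𝓘(ℝ, E) 1 (Ψ t) z ∧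
        ∀ C : ℝ, (∀ τ ∈ Icc 0 t, ‖leviCivita X (Ψ τ z)‖ ≤ C) →
          ∀ V : TangentSpace 𝓘(ℝ, E) z,
            ‖mfderiv 𝓘(ℝ, E) 𝓘(ℝ, E) (Ψ t) z V‖ ≤ Real.exp (C * t) * ‖V‖ := by
  have : CompleteSpace E := FiniteDimensional.complete ℝ E
  have : IsManifold 𝓘(ℝ, E) 1 M := inferInstance
  set e := extChartAt 𝓘(ℝ, E) z₀ with he
  have hf : ContDiffAt ℝ 2 (chartField X z₀) (e z₀) :=
    (contDiffAt_chartField hX z₀ (mem_extChartAt_target z₀)).of_le (WithTop.coe_le_coe.2 le_top)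
  obtain ⟨α, D, W, ε, hε, hW, hyW, h0, hαD, hC1⟩ := exists_localFlow_hasFDerivAt hf
    ((isOpen_extChartAt_target z₀).mem_nhds (mem_extChartAt_target z₀))
  let Ψ : ℝ → M → M := fun t z => e.symm (α (e z) t)
  let U : Set M := e.source ∩ e ⁻¹' W
  have hsrc : ∀ z ∈ e.source, ContMDiffAt 𝓘(ℝ, E) 𝓘(ℝ, E) 1 e z := fun z hz =>
    contMDiffAt_extChartAt' (by simpa [he] using hz)
  refine ⟨Ψ, U, ε, hε, ?_, ⟨mem_extChartAt_source z₀, hyW⟩, ?_, ?_⟩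
  · exact (continuousOn_extChartAt z₀).isOpen_inter_preimage (isOpen_extChartAt_source z₀) hW
  · rintro z ⟨hz, hzW⟩
    refine ⟨by simp only [Ψ, (h0 _ hzW).1, e.left_inv hz], fun t ht => ?_⟩
    obtain ⟨h1, h2, -⟩ := hαD _ hzW t ht
    have h3 := ((contMDiffAt_extChartAt_symm z₀ h1).mdifferentiableAt
      (by simp)).hasMFDerivAt.comp t h2.hasFDerivAt.hasMFDerivAt
    have h4 : HasMFDerivAt 𝓘(ℝ, ℝ) 𝓘(ℝ, E) (fun t => Ψ t z) t
        ((1 : ℝ →L[ℝ] ℝ).smulRight (X (Ψ t z))) := by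
      refine h3.congr_mfderiv ?_
      ext
      exact (congrArg (fun w : E => mfderiv 𝓘(ℝ, E) 𝓘(ℝ, E) e.symm (α (e z) t) w)
        (one_smul ℝ _)).trans ((mfderiv_chartField X z₀ h1).trans (one_smul ℝ _).symm)
    exact h4.hasMFDerivWithinAt
  rintro t ht z ⟨hz, hzW⟩
  have hmem : ∀ τ ∈ Icc 0 t, τ ∈ Ioo (-ε) ε := fun τ hτ =>
    ⟨by linarith [hτ.1], hτ.2.trans_lt ht.2⟩
  have hα : ContDiffAt ℝ 1 (α · t) (e z) :=
    contDiffAt_one_iff.2 ⟨(D · t), W, hW.mem_nhds hzW, (hC1 t ht).2, (hC1 t ht).1⟩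
  have htm := hmem t ⟨ht.1, le_rfl⟩
  have hσ := contMDiffAt_extChartAt_symm z₀ (hαD _ hzW t htm).1
  refine ⟨?_, fun C hC V => ?_⟩
  · exact ContMDiffAt.comp z (hσ.of_le (by simp)) (ContMDiffAt.comp z hα.contMDiffAt (hsrc z hz))
  · let w : E := mfderiv 𝓘(ℝ, E) 𝓘(ℝ, E) e z V
    have hmf : mfderiv 𝓘(ℝ, E) 𝓘(ℝ, E) (Ψ t) z V = chartTangent z₀ (α (e z) t, D (e z) t w) := by
      have h1 : HasMFDerivAt 𝓘(ℝ, E) 𝓘(ℝ, E) (α · t) (e z) (D (e z) t) :=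
        ((hC1 t ht).1 _ hzW).hasMFDerivAt
      have h2 := (hσ.mdifferentiableAt (by simp)).hasMFDerivAt.comp z
        (h1.comp z ((hsrc z hz).mdifferentiableAt one_ne_zero).hasMFDerivAt)
      exact DFunLike.congr_fun h2.mfderiv V
    have hgr := le_mul_exp_of_hasDerivAt_le (t := t) (K := 2 * C)
      (φ := fun τ => chartNormSq z₀ (α (e z) τ, D (e z) τ w))
      (φ' := fun τ => fderiv ℝ (chartNormSq z₀) (α (e z) τ, D (e z) τ w)
        (chartField X z₀ (α (e z) τ), fderiv ℝ (chartField X z₀) (α (e z) τ) (D (e z) τ w)))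
      ht.1 (fun τ hτ => ?_) (fun τ hτ => ?_)
    · rw [(h0 _ hzW).1, (h0 _ hzW).2] at hgr
      have h1 : chartNormSq z₀ (e z, ContinuousLinearMap.id ℝ E w) = ‖V‖ ^ 2 :=
        chartNormSq_mfderiv_extChartAt z₀ hz V
      rw [h1, chartNormSq, ← hmf] at hgr
      refine le_of_sq_le_sq ?_ (by positivity)
      rw [← real_inner_self_eq_norm_sq]
      refine hgr.trans_eq ?_
      rw [mul_pow, ← Real.exp_nat_mul, mul_comm]
      congr 2
      push_cast
      ring
    · obtain ⟨h1, h2, h3⟩ := hαD _ hzW τ (hmem τ hτ)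
      have h4 : HasDerivAt (fun τ => D (e z) τ w)
          (fderiv ℝ (chartField X z₀) (α (e z) τ) (D (e z) τ w)) τ := by
        simpa using h3.clm_apply (hasDerivAt_const τ w)
      exact (differentiableAt_chartNormSq (p := (α (e z) τ, D (e z) τ w)) z₀
        h1).hasFDerivAt.comp_hasDerivAt τ (h2.prodMk h4)
    · exact fderiv_chartNormSq_le hX z₀ (hαD _ hzW τ (hmem τ hτ)).1 _ (hC τ hτ)

end LocalFlow

/-! ### Uniqueness of flow lines and transport of curves -/

section FlowOfCurve

variable {E : Type*} [NormedAddCommGroup E] [NormedSpace ℝ E] [FiniteDimensional ℝ E]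
  {M : Type*} [TopologicalSpace M] [T2Space M] [ChartedSpace E M] [IsManifold 𝓘(ℝ, E) ∞ M]

/-- Uniqueness of integral curves after a time shift by `a`; it identifies a long flow line with a
local flow started midway. -/
theorem IsFlowLine.apply_eq {X : Π x : M, TangentSpace 𝓘(ℝ, E) x}
    (hX : ContMDiff 𝓘(ℝ, E) 𝓘(ℝ, E).tangent ∞ (fun x => (X x : TangentBundle 𝓘(ℝ, E) M)))
    {t : ℝ} {x : M} {γ : ℝ → M} (hγ : IsFlowLine X t x γ) {γ' : ℝ → M} {a ε : ℝ}
    (ha : a ∈ uIcc 0 t) (hγ' : IsMIntegralCurveOn γ' X (Ioo (-ε) ε)) (h : γ' 0 = γ a)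
    (hε : |t - a| < ε) : γ t = γ' (t - a) := by
  have : CompleteSpace E := FiniteDimensional.complete ℝ E
  have : IsManifold 𝓘(ℝ, E) 1 M := inferInstance
  obtain ⟨-, b, b', h0, ht, hint⟩ := hγ
  have hab : a ∈ Ioo b b' := (ordConnected_Ioo.uIcc_subset h0 ht) ha
  have h1 := hγ'.comp_add (-a)
  have hε' := abs_lt.1 hε
  have hε0 : 0 < ε := (abs_nonneg _).trans_lt hε
  have h2 : EqOn γ (γ' ∘ (· + -a)) (Ioo (max b (a - ε)) (min b' (a + ε))) := by
    refine isMIntegralCurveOn_Ioo_eqOn_of_contMDiff_boundaryless (t₀ := a) ?_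
      (hX.of_le (by simp)) (hint.mono ?_) (h1.mono ?_) (by simp [h])
    · simp [hab.1, hab.2, hε0]
    · exact Ioo_subset_Ioo (le_max_left _ _) (min_le_left _ _)
    · rintro τ ⟨h3, h4⟩
      have h5 := (max_lt_iff.1 h3).2
      have h6 := (lt_min_iff.1 h4).2
      constructor <;> simp <;> linarith
  have h7 := @h2 t ⟨max_lt ht.1 (by linarith), lt_min ht.2 (by linarith)⟩
  simpa [sub_eq_add_neg] using h7

/-- The curve chosen in `flow` may change with `t`; uniqueness makes the choice irrelevant. -/
theorem flow_eq_of_isFlowLine {X : Π x : M, TangentSpace 𝓘(ℝ, E) x}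
    (hX : ContMDiff 𝓘(ℝ, E) 𝓘(ℝ, E).tangent ∞ (fun x => (X x : TangentBundle 𝓘(ℝ, E) M)))
    {t : ℝ} {x : M} {γ : ℝ → M} (hγ : IsFlowLine X t x γ) : flow X t x = γ t := by
  have : CompleteSpace E := FiniteDimensional.complete ℝ E
  have : IsManifold 𝓘(ℝ, E) 1 M := inferInstance
  have hex : ∃ γ : ℝ → M, IsFlowLine X t x γ := ⟨γ, hγ⟩
  rw [flow, dif_pos hex]
  obtain ⟨h1, a, b, ha, hb, hab⟩ := hex.choose_spec
  obtain ⟨h1', a', b', ha', hb', hab'⟩ := hγ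
  refine isMIntegralCurveOn_Ioo_eqOn_of_contMDiff_boundaryless (a := max a a') (b := min b b')
    (t₀ := 0) ?_ (hX.of_le (by simp)) (hab.mono ?_) (hab'.mono ?_) (h1.trans h1'.symm) ?_
  · exact ⟨max_lt ha.1 ha'.1, lt_min ha.2 ha'.2⟩
  · exact Ioo_subset_Ioo (le_max_left _ _) (min_le_left _ _)
  · exact Ioo_subset_Ioo (le_max_right _ _) (min_le_right _ _)
  · exact ⟨max_lt hb.1 hb'.1, lt_min hb.2 hb'.2⟩

omit [FiniteDimensional ℝ E] [T2Space M] [IsManifold 𝓘(ℝ, E) ∞ M] in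
theorem IsFlowLine.of_mem_Icc {X : Π x : M, TangentSpace 𝓘(ℝ, E) x} {t : ℝ} {x : M} {γ : ℝ → M}
    (hγ : IsFlowLine X t x γ) {τ : ℝ} (hτ : τ ∈ Icc 0 t) : IsFlowLine X τ x γ := by
  obtain ⟨h, a, b, h0, ht, hab⟩ := hγ
  exact ⟨h, a, b, h0, ordConnected_Ioo.out h0 ht hτ, hab⟩

variable [RiemannianBundle (fun x : M => TangentSpace 𝓘(ℝ, E) x)]
  [IsContMDiffRiemannianBundle 𝓘(ℝ, E) ∞ E (fun x : M => TangentSpace 𝓘(ℝ, E) x)]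

-- The two norms live on tangent spaces at `f s` and `g s`, which are equal only propositionally, so
-- plain rewriting is not available.
omit [FiniteDimensional ℝ E] [T2Space M] [IsManifold 𝓘(ℝ, E) ∞ M]
  [IsContMDiffRiemannianBundle 𝓘(ℝ, E) ∞ E (fun x : M => TangentSpace 𝓘(ℝ, E) x)] in
theorem norm_mfderiv_congr {f g : ℝ → M} {s : ℝ} (h : f =ᶠ[𝓝 s] g) :
    ‖mfderiv 𝓘(ℝ, ℝ) 𝓘(ℝ, E) f s (1 : ℝ)‖ = ‖mfderiv 𝓘(ℝ, ℝ) 𝓘(ℝ, E) g s (1 : ℝ)‖ := by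
  have key : ∀ x y : M, x = y → ∀ v : E,
      @norm (TangentSpace 𝓘(ℝ, E) x) _ v = @norm (TangentSpace 𝓘(ℝ, E) y) _ v := by
    rintro x _ rfl v; rfl
  refine (key _ _ h.eq_of_nhds _).trans ?_
  exact congrArg (fun L : ℝ →L[ℝ] E => @norm (TangentSpace 𝓘(ℝ, E) (g s)) _ (L 1)) h.mfderiv_eq

/-- A `C¹` curve transported by the flow stays `C¹`, and its speed grows at most exponentially. -/
theorem contMDiffAt_flow_curve {X : Π x : M, TangentSpace 𝓘(ℝ, E) x}
    (hX : ContMDiff 𝓘(ℝ, E) 𝓘(ℝ, E).tangent ∞ (fun x => (X x : TangentBundle 𝓘(ℝ, E) M)))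
    {c : ℝ → M} {s₀ : ℝ} (hc : ContMDiffAt 𝓘(ℝ, ℝ) 𝓘(ℝ, E) 1 c s₀) {T : ℝ} (hT : 0 ≤ T)
    {η : ℝ → ℝ → M} (hη : ∀ s, IsFlowLine X T (c s) (η s)) {C : ℝ}
    (hC : ∀ t ∈ Icc 0 T, ‖leviCivita X (η s₀ t)‖ ≤ C) :
    ContMDiffAt 𝓘(ℝ, ℝ) 𝓘(ℝ, E) 1 (fun s => η s T) s₀ ∧
      ‖mfderiv 𝓘(ℝ, ℝ) 𝓘(ℝ, E) (fun s => η s T) s₀ (1 : ℝ)‖ ≤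
        Real.exp (C * T) * ‖mfderiv 𝓘(ℝ, ℝ) 𝓘(ℝ, E) c s₀ (1 : ℝ)‖ := by
  choose Ψ U ε hε hU hzU hΨ hbd using fun τ : ℝ => exists_localFlow_norm_mfderiv_le hX (η s₀ τ)
  have hcont : ContinuousOn (η s₀) (Icc 0 T) := by
    obtain ⟨-, a, b, h0, hT', hab⟩ := hη s₀
    exact fun t ht => (hab t (ordConnected_Ioo.out h0 hT' ht)).continuousWithinAt.mono
      (ordConnected_Ioo.out h0 hT')
  -- Two times in the same piece differ by less than `ε τ`, so the local flow at `η s₀ τ` lasts from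
  -- one partition point to the next.
  let cov : Icc 0 T → Set (Icc 0 T) := fun τ =>
    {t | η s₀ t ∈ U τ ∧ dist (t : ℝ) τ < ε τ / 2}
  obtain ⟨p, hp0, hpm, ⟨m, hm⟩, hcov⟩ := exists_monotone_Icc_subset_open_cover_Icc hT (c := cov)
    (fun τ => by
      refine IsOpen.inter ?_ ?_
      · exact (hU τ).preimage (continuousOn_iff_continuous_domRestrict.1 hcont)
      · exact isOpen_lt (continuous_subtype_val.dist continuous_const) continuous_const)
    (fun τ _ => mem_iUnion.2 ⟨τ, hzU τ, by simpa using hε τ⟩)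
  let P : ℝ → Prop := fun t => ContMDiffAt 𝓘(ℝ, ℝ) 𝓘(ℝ, E) 1 (fun s => η s t) s₀ ∧
    ‖mfderiv 𝓘(ℝ, ℝ) 𝓘(ℝ, E) (fun s => η s t) s₀ (1 : ℝ)‖ ≤
      Real.exp (C * t) * ‖mfderiv 𝓘(ℝ, ℝ) 𝓘(ℝ, E) c s₀ (1 : ℝ)‖
  suffices H : ∀ n, P (p n) by
    change P T
    rw [← hm m le_rfl]
    exact H m
  intro n
  induction n with
  | zero =>
    have h0 : (fun s => η s (p 0)) = c := by
      funext s
      rw [hp0, (hη s).1]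
    refine ⟨by rwa [h0], ?_⟩
    rw [norm_mfderiv_congr (.of_eq h0), hp0]
    simp
  | succ n ih =>
    obtain ⟨hn, hbn⟩ := ih
    obtain ⟨τ, hτ⟩ := hcov n
    have hle : (p n : ℝ) ≤ p (n + 1) := hpm n.le_succ
    obtain ⟨hnU, hnd⟩ := hτ ⟨le_rfl, hpm n.le_succ⟩
    obtain ⟨-, hnd'⟩ := hτ ⟨hpm n.le_succ, le_rfl⟩
    have hlt : ∀ t ∈ Icc (0 : ℝ) (p (n + 1) - p n), t ∈ Ico 0 (ε τ) := by
      intro t ht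
      rw [Real.dist_eq, abs_lt] at hnd hnd'
      exact ⟨ht.1, by linarith [ht.2, hnd.1, hnd'.2]⟩
    have heq : ∀ s, η s (p n) ∈ U τ → ∀ t ∈ Icc (0 : ℝ) (p (n + 1) - p n),
        η s (p n + t) = Ψ τ t (η s (p n)) := by
      intro s hs t ht
      have h1 : (p n : ℝ) + t ∈ Icc 0 T :=
        ⟨add_nonneg (p n).2.1 ht.1, by linarith [ht.2, (p (n + 1)).2.2]⟩
      have h2 := ((hη s).of_mem_Icc h1).apply_eq hX (a := p n) (γ' := fun t => Ψ τ t (η s (p n)))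
        (ε := ε τ) ?_ (hΨ τ _ hs).2 (hΨ τ _ hs).1 ?_
      · simpa using h2
      · rw [uIcc_of_le h1.1]
        exact ⟨(p n).2.1, by linarith [ht.1]⟩
      · have := hlt t ht
        rw [add_sub_cancel_left, abs_of_nonneg ht.1]
        exact this.2
    set d : ℝ := p (n + 1) - p n with hd
    have hdm : d ∈ Icc 0 d := ⟨by rw [hd]; linarith, le_rfl⟩
    -- Continuity in `s` at time `p n`, part of the induction hypothesis, brings nearby curves into
    -- `U τ`.
    have hev : (fun s => η s (p (n + 1))) =ᶠ[𝓝 s₀] Ψ τ d ∘ fun s => η s (p n) := by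
      filter_upwards [hn.continuousAt.eventually_mem ((hU τ).mem_nhds hnU)] with s hs
      have := heq s hs d hdm
      rwa [hd, add_sub_cancel] at this
    obtain ⟨hsm, hnorm⟩ := hbd τ d (hlt d hdm) _ hnU
    refine ⟨(ContMDiffAt.comp s₀ hsm hn).congr_of_eventuallyEq hev, ?_⟩
    have hmf := (hsm.mdifferentiableAt one_ne_zero).hasMFDerivAt.comp s₀
      (hn.mdifferentiableAt one_ne_zero).hasMFDerivAt
    have hval : ‖mfderiv 𝓘(ℝ, ℝ) 𝓘(ℝ, E) (fun s => η s (p (n + 1))) s₀ (1 : ℝ)‖ =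
        ‖mfderiv 𝓘(ℝ, E) 𝓘(ℝ, E) (Ψ τ d) (η s₀ (p n))
          (mfderiv 𝓘(ℝ, ℝ) 𝓘(ℝ, E) (fun s => η s (p n)) s₀ (1 : ℝ))‖ := by
      rw [norm_mfderiv_congr hev, hmf.mfderiv]
      rfl
    rw [hval]
    refine (hnorm C (fun t ht => ?_) _).trans ?_
    · rw [← heq s₀ hnU t ht]
      exact hC _ ⟨add_nonneg (p n).2.1 ht.1, by linarith [ht.2, (p (n + 1)).2.2]⟩
    · calc _ ≤ Real.exp (C * d) * (Real.exp (C * p n) *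
            ‖mfderiv 𝓘(ℝ, ℝ) 𝓘(ℝ, E) c s₀ (1 : ℝ)‖) := by gcongr
        _ = _ := by
          rw [← mul_assoc, ← Real.exp_add]
          congr 2
          rw [hd]
          ring

end FlowOfCurve

/-! ### Lengths, distances and the main estimate -/

open MeasureTheory in
/-- Transporting a curve by the flow increases its length at most by an exponential factor. -/
theorem riemannianEDist_flow_le {E : Type*} [NormedAddCommGroup E] [NormedSpace ℝ E]
    [FiniteDimensional ℝ E]
    {M : Type*} [TopologicalSpace M] [T2Space M] [ChartedSpace E M] [IsManifold 𝓘(ℝ, E) ∞ M]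
    [RiemannianBundle (fun x : M => TangentSpace 𝓘(ℝ, E) x)]
    [IsContMDiffRiemannianBundle 𝓘(ℝ, E) ∞ E (fun x : M => TangentSpace 𝓘(ℝ, E) x)]
    {X : Π x : M, TangentSpace 𝓘(ℝ, E) x}
    (hX : ContMDiff 𝓘(ℝ, E) 𝓘(ℝ, E).tangent ∞ (fun x => (X x : TangentBundle 𝓘(ℝ, E) M)))
    {c : ℝ → M} (hc : ContMDiff 𝓘(ℝ, ℝ) 𝓘(ℝ, E) 1 c) {t : ℝ} (ht : 0 ≤ t) {C : ℝ}
    (hflow : ∀ s, (t, c s) ∈ flowDomain X)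
    (hC : ∀ s, ∀ τ ∈ Icc 0 t, ‖leviCivita X (flow X τ (c s))‖ ≤ C) :
    riemannianEDist 𝓘(ℝ, E) (flow X t (c 0)) (flow X t (c 1)) ≤
      ENNReal.ofReal (Real.exp (C * t)) * pathELength 𝓘(ℝ, E) c 0 1 := by
  -- One flow line for each `s` serves all times in `[0, t]`.
  choose η hη using hflow
  have hfl : ∀ s, ∀ τ ∈ Icc 0 t, flow X τ (c s) = η s τ := fun s τ hτ =>
    flow_eq_of_isFlowLine hX ((hη s).of_mem_Icc hτ)
  have htt : t ∈ Icc 0 t := ⟨ht, le_rfl⟩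
  have key := fun s => contMDiffAt_flow_curve hX (hc s) ht hη (C := C)
    (fun τ hτ => by rw [← hfl s τ hτ]; exact hC s τ hτ)
  refine (riemannianEDist_le_pathELength (γ := fun s => η s t) (a := 0) (b := 1)
    (fun s _ => (key s).1.contMDiffWithinAt) (hfl 0 t htt).symm (hfl 1 t htt).symm
    zero_le_one).trans ?_
  rw [pathELength_eq_lintegral_mfderiv_Icc, pathELength_eq_lintegral_mfderiv_Icc,
    ← lintegral_const_mul' _ _ ENNReal.ofReal_ne_top]
  refine lintegral_mono fun s => ?_
  have := (key s).2
  rw [← ofReal_norm, ← ofReal_norm, ← ENNReal.ofReal_mul (Real.exp_pos _).le]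
  exact ENNReal.ofReal_le_ofReal this

/-- A finite-dimensional Hausdorff manifold is locally compact, hence regular, and then the
Riemannian distance separates points. This settles the case `0 * ∞`. -/
theorem eq_of_riemannianEDist_eq_zero {E : Type*} [NormedAddCommGroup E] [NormedSpace ℝ E]
    [FiniteDimensional ℝ E]
    {M : Type*} [TopologicalSpace M] [T2Space M] [ChartedSpace E M] [IsManifold 𝓘(ℝ, E) ∞ M]
    [RiemannianBundle (fun x : M => TangentSpace 𝓘(ℝ, E) x)]
    [IsContMDiffRiemannianBundle 𝓘(ℝ, E) ∞ E (fun x : M => TangentSpace 𝓘(ℝ, E) x)]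
    {x y : M} (h : riemannianEDist 𝓘(ℝ, E) x y = 0) : x = y := by
  have : LocallyCompactSpace M := Manifold.locallyCompact_of_finiteDimensional 𝓘(ℝ, E)
  have : IsManifold 𝓘(ℝ, E) 1 M := inferInstance
  have : IsContinuousRiemannianBundle E (fun x : M => TangentSpace 𝓘(ℝ, E) x) := by
    obtain ⟨g, hg, hg'⟩ := IsContMDiffRiemannianBundle.exists_contMDiff (IB := 𝓘(ℝ, E)) (n := ∞)
      (F := E) (E := fun x : M => TangentSpace 𝓘(ℝ, E) x)
    exact ⟨g, hg.continuous, hg'⟩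
  let : EMetricSpace M := EMetricSpace.ofRiemannianMetric 𝓘(ℝ, E) M
  exact eq_of_edist_eq_zero h

theorem theorem3
    {E : Type*} [NormedAddCommGroup E] [NormedSpace ℝ E] [FiniteDimensional ℝ E]
    {M : Type*} [TopologicalSpace M] [T2Space M] [ConnectedSpace M]
    [ChartedSpace E M] [IsManifold 𝓘(ℝ, E) ∞ M]
    [RiemannianBundle (fun x : M => TangentSpace 𝓘(ℝ, E) x)]
    [IsContMDiffRiemannianBundle 𝓘(ℝ, E) ∞ E (fun x : M => TangentSpace 𝓘(ℝ, E) x)]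
    (X : Π x : M, TangentSpace 𝓘(ℝ, E) x)
    (hX : ContMDiff 𝓘(ℝ, E) 𝓘(ℝ, E).tangent ∞ (fun x => (X x : TangentBundle 𝓘(ℝ, E) M)))
    -- the submanifold `N` of `M`, with its induced Riemannian metric
    {F : Type*} [NormedAddCommGroup F] [NormedSpace ℝ F] [FiniteDimensional ℝ F]
    (N : Set M) [ChartedSpace F N] [IsManifold 𝓘(ℝ, F) ∞ N]
    [RiemannianBundle (fun x : N => TangentSpace 𝓘(ℝ, F) x)]
    (hN : IsSmoothEmbedding 𝓘(ℝ, F) 𝓘(ℝ, E) ∞ (Subtype.val : N → M))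
    (hNg : ∀ (x : N) (v w : TangentSpace 𝓘(ℝ, F) x),
      inner ℝ v w = inner ℝ (mfderiv 𝓘(ℝ, F) 𝓘(ℝ, E) (Subtype.val : N → M) x v)
        (mfderiv 𝓘(ℝ, F) 𝓘(ℝ, E) (Subtype.val : N → M) x w))
    (hNc : IsCompact (closure N))
    (p₀ q₀ : M) (hp₀ : p₀ ∈ N) (hq₀ : q₀ ∈ N)
    (hd : riemannianEDist 𝓘(ℝ, E) p₀ q₀ =
      riemannianEDist 𝓘(ℝ, F) (⟨p₀, hp₀⟩ : N) ⟨q₀, hq₀⟩)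
    (T : ℝ) (hT : 0 < T) (hflow : Icc 0 T ×ˢ N ⊆ flowDomain X)
    (C : ℝ≥0∞)
    (hC : C = ⨆ p ∈ (fun z : ℝ × M => flow X z.1 z.2) '' (Icc 0 T ×ˢ N), ‖leviCivita X p‖ₑ)
    (t : ℝ) (ht : t ∈ Icc 0 T) :
    riemannianEDist 𝓘(ℝ, E) (flow X t p₀) (flow X t q₀) ≤
      riemannianEDist 𝓘(ℝ, E) p₀ q₀ * EReal.exp ((C * ENNReal.ofReal t : ℝ≥0∞) : EReal) := by
  obtain ⟨ht0, htT⟩ := ht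
  have hsub : ∀ x ∈ N, (t, x) ∈ flowDomain X := fun x hx => hflow ⟨⟨ht0, htT⟩, hx⟩
  -- At time `0` the exponent is `0` even for `C = ⊤`, by `⊤ * 0 = 0`.
  rcases ht0.eq_or_lt with rfl | ht0'
  · have h0 : ∀ x ∈ N, flow X 0 x = x := by
      intro x hx
      obtain ⟨γ, hγ⟩ := hsub x hx
      rw [flow_eq_of_isFlowLine hX hγ, hγ.1]
    simp [h0 _ hp₀, h0 _ hq₀]
  rcases eq_or_ne C ⊤ with hCtop | hCtop
  · have h1 : C * ENNReal.ofReal t = ⊤ := by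
      rw [hCtop, ENNReal.top_mul (by simpa using ht0')]
    rw [h1]
    -- The right side is `⊤` unless the distance vanishes; in that case the points coincide and so
    -- do their images.
    rcases eq_or_ne (riemannianEDist 𝓘(ℝ, E) p₀ q₀) 0 with h2 | h2
    · obtain rfl := eq_of_riemannianEDist_eq_zero h2
      rw [riemannianEDist_self]
      exact bot_le
    · simp [ENNReal.mul_top h2]
  have hexp : EReal.exp ((C * ENNReal.ofReal t : ℝ≥0∞) : EReal) =
      ENNReal.ofReal (Real.exp (C.toReal * t)) := by
    rw [← EReal.exp_coe]
    congr 1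
    conv_lhs => rw [← ENNReal.ofReal_toReal hCtop]
    rw [← ENNReal.ofReal_mul ENNReal.toReal_nonneg, EReal.coe_ennreal_ofReal,
      max_eq_left (by positivity)]
  have hpos : ENNReal.ofReal (Real.exp (C.toReal * t)) ≠ 0 := by
    simpa using Real.exp_pos (C.toReal * t)
  -- With the exponential moved to the left, it is enough to compare with each `r > d_N(p₀,q₀)`, so
  -- no minimizing curve is needed.
  rw [hexp, hd, ← ENNReal.div_le_iff hpos ENNReal.ofReal_ne_top]
  refine le_of_forall_gt fun r hr => ?_
  obtain ⟨γ, hγ0, hγ1, hγ, hlen, -, -⟩ :=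
    exists_lt_locally_constant_of_riemannianEDist_lt hr zero_lt_one
  have hval : ContMDiff 𝓘(ℝ, F) 𝓘(ℝ, E) 1 (Subtype.val : N → M) :=
    hN.contMDiff.of_le (by simp)
  have hc : ContMDiff 𝓘(ℝ, ℝ) 𝓘(ℝ, E) 1 (fun s => (γ s : M)) := hval.comp hγ
  -- The inclusion of `N` is isometric on tangent vectors by `hNg`, so it preserves speeds.
  have hlen' : pathELength 𝓘(ℝ, E) (fun s => (γ s : M)) 0 1 = pathELength 𝓘(ℝ, F) γ 0 1 := by
    simp only [pathELength_eq_lintegral_mfderiv_Icc]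
    congr 1
    funext s
    have h1 := ((hval (γ s)).mdifferentiableAt one_ne_zero).hasMFDerivAt.comp s
      ((hγ s).mdifferentiableAt one_ne_zero).hasMFDerivAt
    have h2 := hNg (γ s) (mfderiv 𝓘(ℝ, ℝ) 𝓘(ℝ, F) γ s (1 : ℝ))
      (mfderiv 𝓘(ℝ, ℝ) 𝓘(ℝ, F) γ s (1 : ℝ))
    rw [real_inner_self_eq_norm_sq, real_inner_self_eq_norm_sq] at h2
    have h3 := (sq_eq_sq₀ (norm_nonneg _) (norm_nonneg _)).1 h2
    rw [← ofReal_norm, ← ofReal_norm]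
    refine congrArg ENNReal.ofReal (Eq.trans ?_ h3.symm)
    have h4 : mfderiv 𝓘(ℝ, ℝ) 𝓘(ℝ, E) (fun s => (γ s : M)) s = _ := h1.mfderiv
    rw [h4]
    rfl
  have hmain := riemannianEDist_flow_le hX hc ht0 (C := C.toReal)
    (fun s => hsub _ (γ s).2) (fun s τ hτ => by
      have h1 : ‖leviCivita X (flow X τ (γ s : M))‖ₑ ≤ C := by
        rw [hC]
        exact le_iSup₂ (f := fun p (_ : p ∈ (fun z : ℝ × M => flow X z.1 z.2) '' (Icc 0 T ×ˢ N)) =>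
          ‖leviCivita X p‖ₑ) _ ⟨(τ, (γ s : M)), ⟨⟨hτ.1, hτ.2.trans htT⟩, (γ s).2⟩, rfl⟩
      exact ENNReal.toReal_mono hCtop h1)
  rw [hγ0, hγ1, hlen', mul_comm] at hmain
  exact (ENNReal.div_le_of_le_mul hmain).trans_lt hlen
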